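/- Let $X$ be a proper metric space (not necessarily geodesic) which is Gromov hyperbolic: there is $\delta\ge 0$ such that $(x|z)_o\ge\min\{(x|y)_o,(y|z)_o\}-\delta$ for all $x,y,z,o\in X$, where $(x|y)_o=\frac12[d(o,x)+d(o,y)-d(x,y)]$. Let $\partial X$ be its hyperbolic boundary, with its usual topology and Borel $\sigma$-algebra, and for $\omega\in\partial X$, $x,y\in X$ put $\beta_\omega(x,y)=\limsup_{z\to\omega}[d(y,z)-d(x,z)]$. The horoball centred at $\omega$ and passing through $p\in X$ is $\{x\in X:\beta_\omega(p,x)\le 0\}$. Let $G$ be a discrete subgroup of the isometry group of $X$, and let $\Lambda=\Lambda_G^{\mathrm{hb}}$ be its big horospheric limit set, i.e. the set of all $\omega\in\partial X$ such that some horoball centred at $\omega$ contains infinitely many points of the orbit $Go$ of a given point $o\in X$. Let $\lambda=\{\lambda_x\}_{x\in X}$ be a purely non-atomic $G$-invariant quasi-conformal stream of dimension $D>0$: the $\lambda_x$ are pairwise equivalent finite non-atomic Borel measures on $\partial X$ with $g\lambda_x=\lambda_{gx}$ for all $g\in G$, $x\in X$, and there is a constant $C>0$ such that for all $x,y\in X$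 $$\Bigl|\log\frac{d\lambda_x}{d\lambda_y}(\omega)-D\beta_\omega(x,y)\Bigr|\le C\quad\text{for almost every }\omega\in\partial X.$$ The following notions, for an action of a countable group $G$ on a measure space $(Y,m)$ by measure class preserving transformations, are understood mod 0. A measurable set $A$ is recurrent (resp. infinitely recurrent) if for a.e. $x\in A$ one has $gx\in A$ for some $g\ne e$ (resp. for infinitely many $g\in G$). It is wandering if its translates $gA$, $g\in G$, are pairwise disjoint. The conservative part is the (unique mod 0) invariant measurable set all of whose measurable subsets are recurrent and whose complement is the union of the translates of a wandering set. The infinitely conservative part, if it exists, is the invariant measurable set all of whose measurable subsets are infinitely recurrent and whose complement is the union of the translates of a measurable set which meets each orbit in at most one point and whose points have finite stabilizers. Then, for the boundary action of $G$ on $(\partial X,\lambda_x)$ with any $x\in X$, and for any $o\in X$: 1. If the action is free mod 0 (that is, for each $g\in G$, $g\neq e$, the set of points of $\partial X$ fixed by $g$ is $\lambda_x$-null), then the conservative part coincides mod 0 with $\Lambda$. 2. Without this assumption, the conservative part coincides mod 0 with the union of $\Lambda$ and the set of boundary points with a non-trivial stabilizer in $G$. 3. Without this assumption, the infinitely conservative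 part exists and coincides mod 0 with $\Lambda$. -/

import Mathlib

open Filter MeasureTheory Set
open scoped Pointwise Topology

/-! ### Gromov hyperbolic spaces and their boundary -/

section Hyperbolic

/-- The Gromov product `(x|y)_o`. -/
noncomputable def gromovProduct {X : Type*} [MetricSpace X] (o x y : X) : ℝ :=
  (dist o x + dist o y - dist x y) / 2

/-- A metric space (not necessarily geodesic) is Gromov hyperbolic if for some `δ ≥ 0` it satisfies
the `δ`-ultrametric inequality for all Gromov products. -/
class GromovHyperbolicSpace (X : Type*) [MetricSpace X] : Prop where
  exists_delta : ∃ δ : ℝ, 0 ≤ δ ∧ ∀ x y z o : X,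
    min (gromovProduct o x y) (gromovProduct o y z) - δ ≤ gromovProduct o x z

/-- A sequence converges to infinity if `(x i|x j)_o → ∞` as `i, j → ∞`
(this does not depend on `o`). -/
def ConvergesToInfinity {X : Type*} [MetricSpace X] (x : ℕ → X) : Prop :=
  ∀ o : X, Tendsto (fun p : ℕ × ℕ => gromovProduct o (x p.1) (x p.2)) atTop atTop

/-- The sequences of points converging to infinity. -/
def SeqToInfinity (X : Type*) [MetricSpace X] : Type _ :=
  {x : ℕ → X // ConvergesToInfinity x}

theorem gromovProduct_comm {X : Type*} [MetricSpace X] (o x y : X) :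
    gromovProduct o x y = gromovProduct o y x := by
  unfold gromovProduct
  rw [dist_comm x y]
  ring

theorem gromovProduct_isometryEquiv {X : Type*} [MetricSpace X] (g : X ≃ᵢ X) (o x y : X) :
    gromovProduct o (g x) (g y) = gromovProduct (g.symm o) x y := by
  have h : ∀ z : X, dist o (g z) = dist (g.symm o) z := fun z => by
    rw [← g.dist_eq (g.symm o) z, g.apply_symm_apply]
  unfold gromovProduct
  rw [h x, h y, g.dist_eq]

/-- Two sequences converging to infinity are equivalent if `(x n|y n)_o → ∞`
(this does not depend on `o`). -/
instance boundarySetoid (X : Type*) [MetricSpace X] [GromovHyperbolicSpace X] :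
    Setoid (SeqToInfinity X) where
  r x y := ∀ o : X, Tendsto (fun n => gromovProduct o (x.1 n) (y.1 n)) atTop atTop
  iseqv :=
    { refl := fun x o => (x.2 o).comp (tendsto_atTop_atTop.2 fun b =>
        ⟨max b.1 b.2, fun n hn =>
          ⟨(le_max_left _ _).trans hn, (le_max_right _ _).trans hn⟩⟩ :
            Tendsto (fun n : ℕ => (n, n)) atTop atTop)
      symm := fun {x y} h o => by
        simpa only [gromovProduct_comm o (y.1 _) (x.1 _)] using h o
      trans := fun {x y z} hxy hyz o => by
        obtain ⟨δ, -, hδ⟩ := GromovHyperbolicSpace.exists_delta (X := X)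
        rw [tendsto_atTop]
        intro b
        filter_upwards [(tendsto_atTop.1 (hxy o)) (b + δ), (tendsto_atTop.1 (hyz o)) (b + δ)]
          with n h1 h2
        have h3 := hδ (x.1 n) (y.1 n) (z.1 n) o
        have h4 := le_min h1 h2
        linarith }

/-- The Gromov (hyperbolic) boundary `∂X`: classes of equivalent sequences converging to
infinity. -/
def HypBoundary (X : Type*) [MetricSpace X] [GromovHyperbolicSpace X] : Type _ :=
  Quotient (boundarySetoid X)

variable {X : Type*} [MetricSpace X] [GromovHyperbolicSpace X]

/-- The boundary point represented by a sequence converging to infinity. -/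
def HypBoundary.mk (x : SeqToInfinity X) : HypBoundary X := Quotient.mk _ x

/-- The image of a sequence converging to infinity under an isometry. -/
def SeqToInfinity.map (g : X ≃ᵢ X) (x : SeqToInfinity X) : SeqToInfinity X :=
  ⟨fun n => g (x.1 n), fun o => by
    simpa only [gromovProduct_isometryEquiv] using x.2 (g.symm o)⟩

/-- The boundary action of the isometry group. -/
instance HypBoundary.instMulAction : MulAction (X ≃ᵢ X) (HypBoundary X) where
  smul g := Quotient.map (SeqToInfinity.map g) fun x y h o => by
    simpa only [SeqToInfinity.map, gromovProduct_isometryEquiv] using h (g.symm o)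
  one_smul ω := by
    induction ω using Quotient.inductionOn with
    | h x => rfl
  mul_smul g h ω := by
    induction ω using Quotient.inductionOn with
    | h x => rfl

/-- The boundary part of a basic neighbourhood of `ω`: the points `η` such that
`(x i|y j)_o ≥ r` for all large `i, j`, for some sequences `x → ω`, `y → η`. -/
def boundaryNhd (ω : HypBoundary X) (o : X) (r : ℝ) : Set (HypBoundary X) :=
  {η | ∃ x y : SeqToInfinity X, HypBoundary.mk x = ω ∧ HypBoundary.mk y = η ∧
    ∀ᶠ p : ℕ × ℕ in atTop, r ≤ gromovProduct o (x.1 p.1) (y.1 p.2)}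

/-- The interior part of a basic neighbourhood of `ω`: the points `z` such that
`(x n|z)_o ≥ r` for all large `n`, for some sequence `x → ω`. -/
def interiorNhd (ω : HypBoundary X) (o : X) (r : ℝ) : Set X :=
  {z | ∃ x : SeqToInfinity X, HypBoundary.mk x = ω ∧
    ∀ᶠ n : ℕ in atTop, r ≤ gromovProduct o (x.1 n) z}

/-- The usual topology of the boundary. -/
instance HypBoundary.instTopologicalSpace : TopologicalSpace (HypBoundary X) where
  IsOpen U := ∀ ω ∈ U, ∀ o : X, ∃ r : ℝ, boundaryNhd ω o r ⊆ U
  isOpen_univ := fun _ _ _ => ⟨0, subset_univ _⟩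
  isOpen_inter := fun U V hU hV ω hω o => by
    obtain ⟨r, hr⟩ := hU ω hω.1 o
    obtain ⟨s, hs⟩ := hV ω hω.2 o
    refine ⟨max r s, fun η hη => ?_⟩
    obtain ⟨x, y, hx, hy, h⟩ := hη
    exact ⟨hr ⟨x, y, hx, hy, h.mono fun p hp => (le_max_left r s).trans hp⟩,
      hs ⟨x, y, hx, hy, h.mono fun p hp => (le_max_right r s).trans hp⟩⟩
  isOpen_sUnion := fun S hS ω hω o => by
    obtain ⟨U, hU, hωU⟩ := hω
    obtain ⟨r, hr⟩ := hS U hU ω hωU o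
    exact ⟨r, hr.trans (subset_sUnion_of_mem hU)⟩

/-- The boundary carries its Borel `σ`-algebra. -/
instance HypBoundary.instMeasurableSpace : MeasurableSpace (HypBoundary X) := borel _

instance HypBoundary.instBorelSpace : BorelSpace (HypBoundary X) := ⟨rfl⟩

/-- The filter on `X` describing convergence `z → ω` to a boundary point within `X ∪ ∂X`. -/
def towards (ω : HypBoundary X) : Filter X :=
  ⨅ (o : X) (r : ℝ), 𝓟 (interiorNhd ω o r)

/-- The Busemann quasi-cocycle `β_ω(x, y) = limsup_{z → ω} (d(y, z) - d(x, z))`. -/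
noncomputable def busemann (ω : HypBoundary X) (x y : X) : ℝ :=
  limsup (fun z : X => dist y z - dist x z) (towards ω)

/-- The horoball centred at `ω` and passing through `p`. -/
def horoball (ω : HypBoundary X) (p : X) : Set X := {x | busemann ω p x ≤ 0}

/-- The big horospheric limit set of `G`, defined through the orbit of `o`: the boundary points
`ω` such that some horoball centred at `ω` contains infinitely many points of the orbit `Go`. -/
def bigHorosphericLimitSet (G : Subgroup (X ≃ᵢ X)) (o : X) : Set (HypBoundary X) :=
  {ω | ∃ p : X, (horoball ω p ∩ range (fun g : G => (g : X ≃ᵢ X) o)).Infinite}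

/-- A family of pairwise equivalent finite Borel measures on `∂X` is a quasi-conformal stream of
dimension `D > 0` if `|log (dλ_x/dλ_y)(ω) - D β_ω(x, y)| ≤ C` for all `x, y` and almost all `ω`,
with a uniform constant `C`. -/
structure IsQuasiConformalStream (D : ℝ) (μ : X → Measure (HypBoundary X)) : Prop where
  dim_pos : 0 < D
  finite : ∀ x, IsFiniteMeasure (μ x)
  equivalent : ∀ x y, μ x ≪ μ y
  exists_bound : ∃ C : ℝ, 0 < C ∧ ∀ x y, ∀ᵐ ω ∂(μ y),
    |Real.log ((μ x).rnDeriv (μ y) ω).toReal - D * busemann ω x y| ≤ C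

/-- The stream is `G`-invariant: `λ_{gx} = g λ_x`. -/
def IsInvariantStream (G : Subgroup (X ≃ᵢ X)) (μ : X → Measure (HypBoundary X)) : Prop :=
  ∀ (g : G) (x : X), μ ((g : X ≃ᵢ X) x) = (μ x).map (fun ω => g • ω)

end Hyperbolic

/-- The subgroup `G` of the isometry group of `X` is discrete in the compact-open topology. -/
def IsDiscreteIsometryGroup {X : Type*} [MetricSpace X] (G : Subgroup (X ≃ᵢ X)) : Prop :=
  @DiscreteTopology G (TopologicalSpace.induced
    (fun g : G => (⟨(g : X ≃ᵢ X), (g : X ≃ᵢ X).continuous⟩ : C(X, X))) inferInstance)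

/-! ### Recurrence and the Hopf decomposition (everything is understood mod 0) -/

section Hopf

variable (G : Type*) [Group G] {Y : Type*} [MeasurableSpace Y] [MulAction G Y]

/-- Almost every point of `A` returns to `A` under some group element `g ≠ 1`. -/
def IsRecurrentSet (m : Measure Y) (A : Set Y) : Prop :=
  ∀ᵐ x ∂m, x ∈ A → ∃ g : G, g ≠ 1 ∧ g • x ∈ A

/-- Almost every point of `A` returns to `A` under infinitely many group elements. -/
def IsInfinitelyRecurrentSet (m : Measure Y) (A : Set Y) : Prop :=
  ∀ᵐ x ∂m, x ∈ A → {g : G | g • x ∈ A}.Infinite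

/-- A measurable set with pairwise disjoint translates. -/
def IsWanderingSet (A : Set Y) : Prop :=
  MeasurableSet A ∧ Pairwise fun g h : G => Disjoint (g • A) (h • A)

/-- A measurable set that meets each orbit in at most one point and whose points have finite
stabilizers. -/
def IsCofiniteSection (A : Set Y) : Prop :=
  MeasurableSet A ∧ ∀ x ∈ A,
    (∀ g : G, g • x ∈ A → g • x = x) ∧ (MulAction.stabilizer G x : Set G).Finite

/-- `C` is (mod 0) the conservative part of the action of `G` on `(Y, m)`: it is measurable and
invariant, the action on `C` is conservative, and the action on the complement of `C` is
completely dissipative. -/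
structure IsConservativePart (m : Measure Y) (C : Set Y) : Prop where
  nullMeasurable : NullMeasurableSet C m
  invariant : ∀ g : G, g • C =ᵐ[m] C
  conservative : ∀ A, MeasurableSet A → A ⊆ C → IsRecurrentSet G m A
  dissipative : ∃ W, IsWanderingSet G W ∧ (⋃ g : G, g • W) =ᵐ[m] Cᶜ

/-- `C` is (mod 0) the infinitely conservative part of the action of `G` on `(Y, m)`: it is
measurable and invariant, every measurable subset of it is infinitely recurrent, and its complement
is the union of the translates of a measurable section consisting of points with finite
stabilizers. -/
structure IsInfinitelyConservativePart (m : Measure Y) (C : Set Y) : Prop where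
  nullMeasurable : NullMeasurableSet C m
  invariant : ∀ g : G, g • C =ᵐ[m] C
  conservative : ∀ A, MeasurableSet A → A ⊆ C → IsInfinitelyRecurrentSet G m A
  dissipative : ∃ W, IsCofiniteSection G W ∧ (⋃ g : G, g • W) =ᵐ[m] Cᶜ

/-- The conservative part is unique mod 0. -/
theorem IsConservativePart.ae_eq {G : Type*} [Group G] [Countable G] {Y : Type*}
    [MeasurableSpace Y] [MulAction G Y] [MeasurableConstSMul G Y] {m : Measure Y} {C C' : Set Y}
    (h : IsConservativePart G m C) (h' : IsConservativePart G m C') : C =ᵐ[m] C' := by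
  have key : ∀ C₁ C₂ : Set Y, IsConservativePart G m C₁ → IsConservativePart G m C₂ →
      C₁ ≤ᵐ[m] C₂ := by
    intro C₁ C₂ h₁ h₂
    obtain ⟨W, ⟨hW, hd⟩, hU⟩ := h₂.dissipative
    have hnull : ∀ g : G, ∀ᵐ x ∂m, x ∉ C₁ ∩ g • W := by
      intro g
      obtain ⟨A, hA, hAm, hAe⟩ :=
        (h₁.nullMeasurable.inter (hW.const_smul g).nullMeasurableSet).exists_measurable_subset_ae_eq
      filter_upwards [h₁.conservative A hAm (hA.trans inter_subset_left), hAe.mem_iff]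
        with x hx hxe hx'
      obtain ⟨k, hk, hkx⟩ := hx (hxe.2 hx')
      have hne : g ≠ k * g := fun he => hk (mul_eq_right.1 he.symm)
      refine disjoint_left.1 (hd hne) (hA hkx).2 ?_
      rw [mul_smul]
      exact smul_mem_smul_set hx'.2
    filter_upwards [ae_all_iff.2 hnull, hU.mem_iff] with x hx hxU hxC
    by_contra hx2
    obtain ⟨g, hg⟩ := mem_iUnion.1 (hxU.2 hx2)
    exact hx g ⟨hxC, hg⟩
  exact (key C C' h h').antisymm (key C' C h' h)

end Hopf

/-! Fix x and put m = λ_x. By invariance, A ↦ m(gA) has density dλ_{g⁻¹x}/dλ_x, whose logarithm F(g,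
ω) is a.e. within C of b(g, ω) = D β_ω(g⁻¹x, x). Hyperbolicity makes β a cocycle up to 6δ and
discreteness makes the action on X proper. Hence, if ∂X has at least two points, ω ∈ Λ exactly when
b(·, ω) does not tend to -∞ along G (`mem_bigHorosphericLimitSet_iff`); this is the condition
`HasInfiniteSuperlevel`.

The rest is measure theory. If the points of B ⊆ A visit A at most N times, the translates of B
cover each point at most N times, so Σ m(gB) < ∞ and Σ exp F(g, ·) converges a.e. on B; this is
impossible on Λ (`IsLogDensity.ae_infinite_of_hasInfiniteSuperlevel`). Off Λ, b(·, ω) attains its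
maximum, only finitely many group elements lead to nearly maximal positions in the orbit, and an
injective Borel map to ℝ selects one of these (`IsLogDensity.exists_isCofiniteSection_ae_eq`). This
is the third claim. The other two follow because a point with non-trivial stabilizer is recurrent at
once, while a section with trivial stabilizers is wandering.

Both F and b are kept: F is measurable but tied to the cocycle identity only almost everywhere, b
satisfies it everywhere up to a constant. -/

section GromovProduct

/-! ### Gromov products. -/

variable {X : Type*} [MetricSpace X]

theorem gromovProduct_self (o x : X) : gromovProduct o x x = dist o x := by
  simp [gromovProduct]

theorem gromovProduct_le_dist_left (o x y : X) : gromovProduct o x y ≤ dist o x := by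
  unfold gromovProduct
  linarith [dist_triangle o x y]

theorem gromovProduct_le_add_dist_base (o o' x y : X) :
    gromovProduct o x y ≤ gromovProduct o' x y + dist o o' := by
  unfold gromovProduct
  linarith [dist_triangle o o' x, dist_triangle o o' y]

theorem gromovProduct_le_add_dist_left (o x x' y : X) :
    gromovProduct o x y ≤ gromovProduct o x' y + dist x x' := by
  unfold gromovProduct
  linarith [dist_triangle o x' x, dist_triangle x' x y, dist_comm x x']

theorem dist_sub_dist_eq_gromovProduct (x y z : X) :
    dist y z - dist x z = dist x y - 2 * gromovProduct x y z := by
  unfold gromovProduct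
  ring

theorem abs_dist_sub_dist_le (x y z : X) : |dist y z - dist x z| ≤ dist x y := by
  rw [dist_comm x y]
  exact abs_dist_sub_le y x z

/-- The `δ`-ultrametric inequality for Gromov products, for a given `δ`. -/
def IsHyperbolicConst (X : Type*) [MetricSpace X] (δ : ℝ) : Prop :=
  0 ≤ δ ∧ ∀ x y z o : X,
    min (gromovProduct o x y) (gromovProduct o y z) - δ ≤ gromovProduct o x z

theorem IsHyperbolicConst.le_gromovProduct {δ : ℝ} (hδ : IsHyperbolicConst X δ) {o x y z : X}
    {r : ℝ} (h₁ : r + δ ≤ gromovProduct o x y) (h₂ : r + δ ≤ gromovProduct o y z) :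
    r ≤ gromovProduct o x z := by
  have := hδ.2 x y z o
  have := le_min h₁ h₂
  linarith

theorem IsHyperbolicConst.le_gromovProduct₃ {δ : ℝ} (hδ : IsHyperbolicConst X δ) {o x y z w : X}
    {r : ℝ} (h₁ : r + 2 * δ ≤ gromovProduct o x y) (h₂ : r + 2 * δ ≤ gromovProduct o y z)
    (h₃ : r + 2 * δ ≤ gromovProduct o z w) : r ≤ gromovProduct o x w := by
  have h0 := hδ.1
  exact hδ.le_gromovProduct (y := z) (hδ.le_gromovProduct (y := y) (by linarith) (by linarith))
    (by linarith)

end GromovProduct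

/-! ### The boundary and convergence to it. -/

section Boundary

variable {X : Type*} [MetricSpace X]

theorem ConvergesToInfinity.eventually_le {a : ℕ → X} (ha : ConvergesToInfinity a) (o : X)
    (r : ℝ) : ∃ N, ∀ m n, N ≤ m → N ≤ n → r ≤ gromovProduct o (a m) (a n) := by
  obtain ⟨N, hN⟩ := eventually_atTop.1 ((tendsto_atTop.1 (ha o)) r)
  exact ⟨max N.1 N.2, fun m n hm hn =>
    hN (m, n) ⟨(le_max_left _ _).trans hm, (le_max_right _ _).trans hn⟩⟩

variable [GromovHyperbolicSpace X]

theorem exists_isHyperbolicConst (X : Type*) [MetricSpace X] [GromovHyperbolicSpace X] :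
    ∃ δ, IsHyperbolicConst X δ :=
  GromovHyperbolicSpace.exists_delta

theorem HypBoundary.exists_mk (ω : HypBoundary X) : ∃ a : SeqToInfinity X, HypBoundary.mk a = ω :=
  Quotient.exists_rep ω

theorem HypBoundary.mk_eq_iff {a b : SeqToInfinity X} :
    HypBoundary.mk a = HypBoundary.mk b ↔
      ∀ o : X, Tendsto (fun n => gromovProduct o (a.1 n) (b.1 n)) atTop atTop :=
  Quotient.eq

/-- It suffices to check equivalence of sequences at one base point. -/
theorem HypBoundary.mk_eq_of_forall {a b : SeqToInfinity X} (o : X)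
    (h : ∀ r, ∀ᶠ n in atTop, r ≤ gromovProduct o (a.1 n) (b.1 n)) :
    HypBoundary.mk a = HypBoundary.mk b := by
  refine HypBoundary.mk_eq_iff.2 fun o' => tendsto_atTop.2 fun r => ?_
  filter_upwards [h (r + dist o o')] with n hn
  linarith [gromovProduct_le_add_dist_base o o' (a.1 n) (b.1 n)]

theorem HypBoundary.eventually_le_of_mk_eq {a b : SeqToInfinity X}
    (h : HypBoundary.mk a = HypBoundary.mk b) (o : X) (r : ℝ) :
    ∀ᶠ n in atTop, r ≤ gromovProduct o (a.1 n) (b.1 n) :=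
  (tendsto_atTop.1 (HypBoundary.mk_eq_iff.1 h o)) r

theorem boundaryNhd_subset_base (ω : HypBoundary X) (o o' : X) (r : ℝ) :
    boundaryNhd ω o (r + dist o o') ⊆ boundaryNhd ω o' r := by
  rintro z ⟨a, b, ha, hb, h⟩
  refine ⟨a, b, ha, hb, h.mono fun n hn => ?_⟩
  linarith [gromovProduct_le_add_dist_base o o' (a.1 n.1) (b.1 n.2)]

theorem interiorNhd_mem_towards (ω : HypBoundary X) (o : X) (r : ℝ) :
    interiorNhd ω o r ∈ towards ω :=
  mem_iInf_of_mem o (mem_iInf_of_mem r (mem_principal_self _))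

theorem tendsto_towards (a : SeqToInfinity X) :
    Tendsto a.1 atTop (towards (HypBoundary.mk a)) := by
  refine tendsto_iInf.2 fun o => tendsto_iInf.2 fun r => tendsto_principal.2 ?_
  obtain ⟨N, hN⟩ := a.2.eventually_le o r
  filter_upwards [eventually_ge_atTop N] with n hn
  exact ⟨a, rfl, (eventually_ge_atTop N).mono fun m hm => hN m n hm hn⟩

instance towards_neBot (ω : HypBoundary X) : (towards ω).NeBot := by
  obtain ⟨a, rfl⟩ := ω.exists_mk
  exact (tendsto_towards a).neBot

theorem IsHyperbolicConst.le_gromovProduct_of_mem_interiorNhd {δ : ℝ}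
    (hδ : IsHyperbolicConst X δ) {ω : HypBoundary X} {o z z' : X} {r : ℝ}
    (hz : z ∈ interiorNhd ω o (r + 2 * δ)) (hz' : z' ∈ interiorNhd ω o (r + 2 * δ)) :
    r ≤ gromovProduct o z z' := by
  obtain ⟨a, ha, h⟩ := hz
  obtain ⟨b, hb, h'⟩ := hz'
  obtain ⟨n, hn, hn', hab⟩ :=
    (h.and (h'.and (HypBoundary.eventually_le_of_mk_eq (ha.trans hb.symm) o (r + 2 * δ)))).exists
  exact hδ.le_gromovProduct₃ (gromovProduct_comm o z _ ▸ hn) hab hn'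

/-! ### The Busemann quasi-cocycle -/

theorem le_busemann_of_eventually {ω : HypBoundary X} {x y : X} {c : ℝ}
    (h : ∀ᶠ z in towards ω, c ≤ dist y z - dist x z) : c ≤ busemann ω x y :=
  le_limsup_of_frequently_le h.frequently
    (isBoundedUnder_of ⟨dist x y, fun z => (abs_le.1 (abs_dist_sub_dist_le x y z)).2⟩)

theorem busemann_le_of_eventually {ω : HypBoundary X} {x y : X} {c : ℝ}
    (h : ∀ᶠ z in towards ω, dist y z - dist x z ≤ c) : busemann ω x y ≤ c :=
  limsup_le_of_le (IsCoboundedUnder.of_frequently_ge (a := -dist x y)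
    (Eventually.of_forall fun z => (abs_le.1 (abs_dist_sub_dist_le x y z)).1).frequently) h

theorem abs_busemann_le (ω : HypBoundary X) (x y : X) : |busemann ω x y| ≤ dist x y :=
  abs_le.2 ⟨le_busemann_of_eventually <| Eventually.of_forall fun z =>
      (abs_le.1 (abs_dist_sub_dist_le x y z)).1,
    busemann_le_of_eventually <| Eventually.of_forall fun z =>
      (abs_le.1 (abs_dist_sub_dist_le x y z)).2⟩

theorem IsHyperbolicConst.eventually_abs_busemann_sub_le {δ : ℝ} (hδ : IsHyperbolicConst X δ)
    (ω : HypBoundary X) (x y : X) :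
    ∀ᶠ z in towards ω, |busemann ω x y - (dist y z - dist x z)| ≤ 2 * δ := by
  -- The radius forces (z|z')_x ≥ d(x, y) ≥ (y|z')_x, so the ultrametric inequality reduces to
  -- (y|z')_x - δ ≤ (y|z)_x; doubling gives 2δ.
  have key : ∀ z ∈ interiorNhd ω x (dist x y + 2 * δ), ∀ z' ∈ interiorNhd ω x (dist x y + 2 * δ),
      dist y z - dist x z ≤ dist y z' - dist x z' + 2 * δ := by
    intro z hz z' hz'
    have h₁ := hδ.le_gromovProduct_of_mem_interiorNhd hz hz'
    have h₂ := hδ.2 y z z' x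
    have h₃ := hδ.2 y z' z x
    have h₄ := gromovProduct_le_dist_left x y z'
    rw [dist_sub_dist_eq_gromovProduct x y z, dist_sub_dist_eq_gromovProduct x y z']
    rw [min_eq_left ((h₄.trans h₁).trans_eq (gromovProduct_comm x z z'))] at h₃
    linarith
  have hmem := interiorNhd_mem_towards ω x (dist x y + 2 * δ)
  filter_upwards [hmem] with z hz
  refine abs_le.2 ⟨?_, ?_⟩
  · have : dist y z - dist x z - 2 * δ ≤ busemann ω x y := by
      refine le_busemann_of_eventually ?_
      filter_upwards [hmem] with z' hz'
      linarith [key z hz z' hz']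
    linarith
  · have : busemann ω x y ≤ dist y z - dist x z + 2 * δ := by
      refine busemann_le_of_eventually ?_
      filter_upwards [hmem] with z' hz'
      exact key z' hz' z hz
    linarith

/-- The differences d(y, w) - d(x, w) form an exact cocycle; at one w close to ω each of the three
terms is off by at most 2δ. -/
theorem IsHyperbolicConst.abs_busemann_add_sub_le {δ : ℝ} (hδ : IsHyperbolicConst X δ)
    (ω : HypBoundary X) (x y z : X) :
    |busemann ω x z - busemann ω x y - busemann ω y z| ≤ 6 * δ := by
  obtain ⟨w, h₁, h₂, h₃⟩ := ((hδ.eventually_abs_busemann_sub_le ω x z).and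
    ((hδ.eventually_abs_busemann_sub_le ω x y).and
      (hδ.eventually_abs_busemann_sub_le ω y z))).exists
  rw [abs_le] at *
  constructor <;> linarith

/-- Otherwise, for p far out towards some η ≠ ω, the value β_ω(x, p) ≈ d(x, p) - 2(p|z)_x stays
bounded as z → ω. Then (p|z)_x is about d(x, p)/2 or more, hence large, and η = ω. -/
theorem IsHyperbolicConst.exists_le_busemann {δ : ℝ} (hδ : IsHyperbolicConst X δ)
    [Nontrivial (HypBoundary X)] (ω : HypBoundary X) (x : X) (c : ℝ) :
    ∃ p, c ≤ busemann ω x p := by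
  by_contra! hc
  obtain ⟨η, hη⟩ := exists_ne ω
  obtain ⟨a, rfl⟩ := ω.exists_mk
  obtain ⟨b, rfl⟩ := η.exists_mk
  refine hη (HypBoundary.mk_eq_of_forall x fun r => ?_)
  obtain ⟨N, hN⟩ := b.2.eventually_le x (2 * |r + δ| + |c + 2 * δ|)
  have hd := hN N N le_rfl le_rfl
  rw [gromovProduct_self] at hd
  filter_upwards [(tendsto_towards a).eventually
    (hδ.eventually_abs_busemann_sub_le (HypBoundary.mk a) x (b.1 N)), eventually_ge_atTop N]
    with n hn hNn
  rw [dist_sub_dist_eq_gromovProduct] at hn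
  have h₁ := hc (b.1 N)
  have h₂ := (abs_le.1 hn).1
  have h₃ := le_abs_self (r + δ)
  have h₄ := le_abs_self (c + 2 * δ)
  have h₅ := abs_nonneg (r + δ)
  have h₆ := abs_nonneg (c + 2 * δ)
  refine hδ.le_gromovProduct (y := b.1 N) ?_ ?_
  · linarith [hN n N hNn le_rfl]
  · linarith

/-! ### Equivariance -/

theorem smul_mem_boundaryNhd (g : X ≃ᵢ X) {ω η : HypBoundary X} {o : X} {r : ℝ}
    (h : η ∈ boundaryNhd ω o r) : g • η ∈ boundaryNhd (g • ω) (g o) r := by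
  obtain ⟨a, b, rfl, rfl, h⟩ := h
  refine ⟨a.map g, b.map g, rfl, rfl, h.mono fun p hp => ?_⟩
  simpa only [SeqToInfinity.map, gromovProduct_isometryEquiv, g.symm_apply_apply] using hp

theorem smul_mem_interiorNhd (g : X ≃ᵢ X) {ω : HypBoundary X} {z o : X} {r : ℝ}
    (h : z ∈ interiorNhd ω o r) : g z ∈ interiorNhd (g • ω) (g o) r := by
  obtain ⟨a, rfl, h⟩ := h
  refine ⟨a.map g, rfl, h.mono fun p hp => ?_⟩
  simpa only [SeqToInfinity.map, gromovProduct_isometryEquiv, g.symm_apply_apply] using hp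

theorem tendsto_towards_smul (g : X ≃ᵢ X) (ω : HypBoundary X) :
    Tendsto g (towards ω) (towards (g • ω)) := by
  refine tendsto_iInf.2 fun o => tendsto_iInf.2 fun r => tendsto_principal.2 ?_
  filter_upwards [interiorNhd_mem_towards ω (g.symm o) r] with z hz
  simpa using smul_mem_interiorNhd g hz

theorem map_towards (g : X ≃ᵢ X) (ω : HypBoundary X) : map g (towards ω) = towards (g • ω) := by
  refine le_antisymm (tendsto_towards_smul g ω) ?_
  have h := map_mono (m := g) (tendsto_towards_smul g⁻¹ (g • ω))
  rw [inv_smul_smul, map_map] at h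
  convert h using 1
  rw [show ((g : X → X) ∘ (g⁻¹ : X ≃ᵢ X)) = id from funext fun z => g.apply_symm_apply z, map_id]

theorem busemann_smul (g : X ≃ᵢ X) (ω : HypBoundary X) (x y : X) :
    busemann (g • ω) (g x) (g y) = busemann ω x y := by
  unfold busemann
  rw [← map_towards, limsup, map_map, limsup]
  congr 2
  funext z
  simp [g.dist_eq]

instance HypBoundary.instContinuousConstSMul : ContinuousConstSMul (X ≃ᵢ X) (HypBoundary X) where
  continuous_const_smul g := by
    refine continuous_def.2 fun U hU ω hω o => ?_
    obtain ⟨r, hr⟩ := hU (g • ω) hω (g o)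
    exact ⟨r, fun η hη => hr (smul_mem_boundaryNhd g hη)⟩

/-! ### Countable separation of the boundary -/

theorem mem_boundaryNhd_self (ω : HypBoundary X) (o : X) (r : ℝ) : ω ∈ boundaryNhd ω o r := by
  obtain ⟨a, rfl⟩ := ω.exists_mk
  exact ⟨a, a, rfl, rfl, (tendsto_atTop.1 (a.2 o)) r⟩

theorem IsHyperbolicConst.boundaryNhd_trans {δ : ℝ} (hδ : IsHyperbolicConst X δ)
    {ω η ζ : HypBoundary X} {o : X} {r : ℝ} (h₁ : η ∈ boundaryNhd ω o (r + 2 * δ))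
    (h₂ : ζ ∈ boundaryNhd η o (r + 2 * δ)) : ζ ∈ boundaryNhd ω o r := by
  obtain ⟨a, b, rfl, hb, hab⟩ := h₁
  obtain ⟨b', c, hb', rfl, hbc⟩ := h₂
  refine ⟨a, c, rfl, rfl, ?_⟩
  obtain ⟨⟨N₁, N₂⟩, hN⟩ := eventually_atTop.1 hab
  obtain ⟨⟨M₁, M₂⟩, hM⟩ := eventually_atTop.1 hbc
  obtain ⟨k, hk, hkN, hkM⟩ := ((HypBoundary.eventually_le_of_mk_eq (hb.trans hb'.symm) o
    (r + 2 * δ)).and ((eventually_ge_atTop N₂).and (eventually_ge_atTop M₁))).exists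
  filter_upwards [eventually_ge_atTop (N₁, M₂)] with p hp
  exact hδ.le_gromovProduct₃ (hN (p.1, k) ⟨hp.1, hkN⟩) hk (hM (k, p.2) ⟨hkM, hp.2⟩)

/-- Basic neighbourhoods need not be open; this provides an open subset of T containing every centre
of a basic neighbourhood inside T. -/
theorem IsHyperbolicConst.isOpen_setOf_boundaryNhd_subset {δ : ℝ} (hδ : IsHyperbolicConst X δ)
    (o : X) (T : Set (HypBoundary X)) : IsOpen {ω | ∃ r, boundaryNhd ω o r ⊆ T} := by
  rintro ω ⟨r, hr⟩ o'
  refine ⟨r + 2 * δ + dist o' o, fun η hη => ⟨r + 2 * δ, fun ζ hζ => hr ?_⟩⟩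
  exact hδ.boundaryNhd_trans (boundaryNhd_subset_base ω o' o _ hη) hζ

theorem IsHyperbolicConst.mem_interiorNhd_of_mem_boundaryNhd {δ : ℝ} (hδ : IsHyperbolicConst X δ)
    {ω η : HypBoundary X} {o z : X} {r : ℝ} (hz : z ∈ interiorNhd ω o (r + 2 * δ))
    (hη : η ∈ boundaryNhd ω o (r + 2 * δ)) : z ∈ interiorNhd η o r := by
  obtain ⟨a, ha, haz⟩ := hz
  obtain ⟨a', b, ha', rfl, hab⟩ := hη
  refine ⟨b, rfl, ?_⟩
  obtain ⟨⟨N₁, N₂⟩, hN⟩ := eventually_atTop.1 hab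
  obtain ⟨k, hk, hkN, hkz⟩ := ((HypBoundary.eventually_le_of_mk_eq (ha'.trans ha.symm) o
    (r + 2 * δ)).and ((eventually_ge_atTop N₁).and haz)).exists
  filter_upwards [eventually_ge_atTop N₂] with n hn
  refine hδ.le_gromovProduct₃ ?_ hk hkz
  rw [gromovProduct_comm]
  exact hN (k, n) ⟨hkN, hn⟩

/-- A boundary point is determined by which points of a countable dense set lie in its
neighbourhoods of integer radius. This supplies the injective Borel map to ℝ behind measurable
sections and fixed-point sets. -/
theorem HypBoundary.countablySeparated [TopologicalSpace.SeparableSpace X] (o : X) :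
    MeasurableSpace.CountablySeparated (HypBoundary X) := by
  obtain ⟨δ, hδ⟩ := exists_isHyperbolicConst X
  have := Nonempty.intro o
  let U : ℕ × ℕ → Set (HypBoundary X) := fun p => {ω | ∃ r, boundaryNhd ω o r ⊆
    {η | TopologicalSpace.denseSeq X p.1 ∈ interiorNhd η o p.2}}
  refine ⟨⟨range U, countable_range U, ?_, ?_⟩⟩
  · rintro _ ⟨p, rfl⟩
    exact (hδ.isOpen_setOf_boundaryNhd_subset o _).measurableSet
  · intro ω _ η _ h
    obtain ⟨a, rfl⟩ := ω.exists_mk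
    obtain ⟨b, rfl⟩ := η.exists_mk
    refine HypBoundary.mk_eq_of_forall o fun r => ?_
    obtain ⟨s, hs⟩ := exists_nat_ge (r + 2 * δ)
    obtain ⟨N, hN⟩ := a.2.eventually_le o (s + 2 * δ + 1)
    obtain ⟨k, hk⟩ := (TopologicalSpace.denseRange_denseSeq X).exists_dist_lt (a.1 N) one_pos
    have haz : ∀ n, N ≤ n →
        s + 2 * δ ≤ gromovProduct o (a.1 n) (TopologicalSpace.denseSeq X k) := by
      intro n hn
      rw [gromovProduct_comm]
      linarith [gromovProduct_le_add_dist_left o (a.1 N) (TopologicalSpace.denseSeq X k) (a.1 n),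
        hN N n le_rfl hn]
    have hω : HypBoundary.mk a ∈ U (k, s) := ⟨s + 2 * δ, fun ζ hζ =>
      hδ.mem_interiorNhd_of_mem_boundaryNhd
        ⟨a, rfl, (eventually_ge_atTop N).mono haz⟩ hζ⟩
    obtain ⟨t, ht⟩ := (h _ (mem_range_self (k, s))).1 hω
    obtain ⟨b', hb', hbz⟩ := ht (mem_boundaryNhd_self _ o t)
    have h0 := hδ.1
    filter_upwards [hbz, HypBoundary.eventually_le_of_mk_eq hb' o (r + 2 * δ),
      eventually_ge_atTop N] with n h₁ h₂ h₃
    refine hδ.le_gromovProduct₃ (y := TopologicalSpace.denseSeq X k) (z := b'.1 n) ?_ ?_ h₂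
    · linarith [haz n h₃]
    · rw [gromovProduct_comm]
      exact hs.trans h₁

end Boundary

/-! ### Discrete groups of isometries act properly -/

section Discrete

variable {X : Type*} [MetricSpace X]

theorem IsDiscreteIsometryGroup.exists_isCompact_forall_eq_one {G : Subgroup (X ≃ᵢ X)}
    (hG : IsDiscreteIsometryGroup G) : ∃ K : Set X, IsCompact K ∧ ∃ ε > 0, ∀ g : G,
      (∀ z ∈ K, dist z ((g : X ≃ᵢ X) z) < ε) → g = 1 := by
  let ι : G → C(X, X) := fun g => ⟨(g : X ≃ᵢ X), (g : X ≃ᵢ X).continuous⟩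
  let _ : TopologicalSpace G := TopologicalSpace.induced ι inferInstance
  have hd : DiscreteTopology G := hG
  have h1 : ({1} : Set G) ∈ 𝓝 (1 : G) := (isOpen_discrete _).mem_nhds rfl
  rw [nhds_induced, mem_comap] at h1
  obtain ⟨V, hV, hV1⟩ := h1
  obtain ⟨⟨K, ε⟩, ⟨hK, hε⟩, h⟩ := (nhds_basis_uniformity
    (Metric.uniformity_basis_dist.compactConvergenceUniformity (α := X))).mem_iff.1 hV
  refine ⟨K, hK, ε, hε, fun g hg => hV1 (h ?_)⟩
  intro z hz
  simpa [ι, dist_comm] using hg z hz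

theorem IsDiscreteIsometryGroup.finite_setOf_dist_le [ProperSpace X] {G : Subgroup (X ≃ᵢ X)}
    (hG : IsDiscreteIsometryGroup G) (o p : X) (R : ℝ) :
    {g : G | dist ((g : X ≃ᵢ X) o) p ≤ R}.Finite := by
  obtain ⟨K, hK, ε, hε, h⟩ := hG.exists_isCompact_forall_eq_one
  have he : 0 < ε / 4 := by positivity
  obtain ⟨t, htK, ht, hKt⟩ := finite_cover_balls_of_compact hK he
  obtain ⟨r, hr⟩ := hK.isBounded.subset_closedBall o
  obtain ⟨S, -, hS, hRS⟩ := finite_cover_balls_of_compact (isCompact_closedBall p (r + R)) he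
  have hex : ∀ (g : {g : G | dist ((g : X ≃ᵢ X) o) p ≤ R}) (s : t),
      ∃ u : S, dist (((g : G) : X ≃ᵢ X) s) u < ε / 4 := by
    intro g s
    have hs : dist (s : X) o ≤ r := hr (htK s.2)
    have hg : dist (((g : G) : X ≃ᵢ X) o) p ≤ R := g.2
    have hmem : ((g : G) : X ≃ᵢ X) s ∈ Metric.closedBall p (r + R) :=
      (dist_triangle _ (((g : G) : X ≃ᵢ X) o) _).trans
        (add_le_add ((IsometryEquiv.dist_eq _ _ _).trans_le hs) hg)
    obtain ⟨u, hu, hsu⟩ := mem_iUnion₂.1 (hRS hmem)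
    exact ⟨⟨u, hu⟩, hsu⟩
  choose c hc using hex
  have := ht.to_subtype
  have := hS.to_subtype
  -- Arzelà–Ascoli by pigeonhole: `c` records where g sends an ε/4-net of K, up to ε/4, and takes
  -- finitely many values. Elements with equal records differ by less than 4 · ε/4 on K, hence
  -- coincide.
  refine Set.finite_coe_iff.1 (Finite.of_injective c fun g k hgk => Subtype.ext ?_)
  refine (inv_mul_eq_one.1 (h _ fun z hz => ?_))
  obtain ⟨s, hs, hzs⟩ := mem_iUnion₂.1 (hKt hz)
  have h₁ := hc g ⟨s, hs⟩
  have h₂ := hc k ⟨s, hs⟩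
  rw [← hgk] at h₂
  have h₃ : dist (((g : G) : X ≃ᵢ X) z) (((g : G) : X ≃ᵢ X) s) < ε / 4 := by
    rwa [IsometryEquiv.dist_eq]
  have h₄ : dist (((k : G) : X ≃ᵢ X) z) (((k : G) : X ≃ᵢ X) s) < ε / 4 := by
    rwa [IsometryEquiv.dist_eq]
  have h₅ : dist z ((((g : G)⁻¹ * k : G) : X ≃ᵢ X) z)
      = dist (((g : G) : X ≃ᵢ X) z) (((k : G) : X ≃ᵢ X) z) := by
    rw [← IsometryEquiv.dist_eq ((g : G) : X ≃ᵢ X) z]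
    congr 1
    exact IsometryEquiv.apply_symm_apply _ _
  rw [h₅]
  refine (dist_triangle4_right _ _ (((g : G) : X ≃ᵢ X) s) (((k : G) : X ≃ᵢ X) s)).trans_lt ?_
  have h₆ := dist_triangle_right (((g : G) : X ≃ᵢ X) s) (((k : G) : X ≃ᵢ X) s)
    (c g ⟨s, hs⟩ : X)
  linarith

theorem IsDiscreteIsometryGroup.countable [ProperSpace X] {G : Subgroup (X ≃ᵢ X)}
    (hG : IsDiscreteIsometryGroup G) (o : X) : Countable G := by
  refine countable_univ_iff.1 ((countable_iUnion fun n : ℕ =>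
    (hG.finite_setOf_dist_le o o n).countable).mono fun g _ => mem_iUnion.2 ?_)
  exact exists_nat_ge (dist ((g : X ≃ᵢ X) o) o)

end Discrete

/-! ### Functions that do not tend to -∞. -/

section Superlevel

variable {ι : Type*}

/-- Infinitely many values `f g`, `g : ι`, exceed some constant. -/
def HasInfiniteSuperlevel {ι : Type*} (f : ι → ℝ) : Prop := ∃ c : ℝ, {g | c ≤ f g}.Infinite

theorem HasInfiniteSuperlevel.of_le_add {f f' : ι → ℝ} (h : HasInfiniteSuperlevel f) {C : ℝ}
    (hC : ∀ g, f g ≤ f' g + C) : HasInfiniteSuperlevel f' := by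
  obtain ⟨c, hc⟩ := h
  exact ⟨c - C, hc.mono fun g (hg : c ≤ f g) => show c - C ≤ f' g by linarith [hC g]⟩

theorem hasInfiniteSuperlevel_congr {f f' : ι → ℝ} {C : ℝ} (hC : ∀ g, |f g - f' g| ≤ C) :
    HasInfiniteSuperlevel f ↔ HasInfiniteSuperlevel f' :=
  ⟨fun h => h.of_le_add (C := C) fun g => by linarith [(abs_le.1 (hC g)).2],
    fun h => h.of_le_add (C := C) fun g => by linarith [(abs_le.1 (hC g)).1]⟩

theorem HasInfiniteSuperlevel.comp_equiv {f : ι → ℝ} (h : HasInfiniteSuperlevel f) (e : ι ≃ ι) :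
    HasInfiniteSuperlevel (f ∘ e) := by
  obtain ⟨c, hc⟩ := h
  exact ⟨c, hc.preimage fun g _ => e.surjective g⟩

variable {Y : Type*} [MeasurableSpace Y]

theorem measurableSet_setOf_infinite [Countable ι] {p : ι → Y → Prop}
    (hp : ∀ i, MeasurableSet {y | p i y}) : MeasurableSet {y | {i | p i y}.Infinite} := by
  have : {y | {i | p i y}.Infinite} = ⋂ s : Finset ι, ⋃ i : {i // i ∉ s}, {y | p i y} := by
    ext y
    simp only [mem_ofPred_eq, mem_iInter, mem_iUnion]
    constructor
    · intro h s
      obtain ⟨i, hi, his⟩ := h.exists_notMem_finset s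
      exact ⟨⟨i, his⟩, hi⟩
    · intro h hfin
      obtain ⟨⟨i, hi⟩, hpi⟩ := h hfin.toFinset
      exact hi (hfin.mem_toFinset.2 hpi)
  rw [this]
  exact MeasurableSet.iInter fun s => MeasurableSet.iUnion fun i => hp i

theorem measurableSet_setOf_hasInfiniteSuperlevel [Countable ι] {F : ι → Y → ℝ}
    (hF : ∀ g, Measurable (F g)) : MeasurableSet {y | HasInfiniteSuperlevel fun g => F g y} := by
  have : {y | HasInfiniteSuperlevel fun g => F g y} =
      ⋃ n : ℕ, {y | {g | -(n : ℝ) ≤ F g y}.Infinite} := by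
    ext y
    simp only [mem_ofPred_eq, mem_iUnion]
    constructor
    · rintro ⟨c, hc⟩
      obtain ⟨n, hn⟩ := exists_nat_ge (-c)
      exact ⟨n, hc.mono fun g (hg : c ≤ F g y) => show -(n : ℝ) ≤ F g y by linarith⟩
    · rintro ⟨n, hn⟩
      exact ⟨_, hn⟩
  rw [this]
  exact MeasurableSet.iUnion fun n => measurableSet_setOf_infinite fun g =>
    measurableSet_le measurable_const (hF g)

end Superlevel

/-! ### Quasi-cocycles and invariance along orbits. -/

section QuasiCocycle

variable {G : Type*} [Group G] {Y : Type*} [MulAction G Y]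

/-- A function on `G × Y` satisfying the additive cocycle identity up to a constant. -/
def IsQuasiCocycle (K : ℝ) (b : G → Y → ℝ) : Prop :=
  ∀ g h y, |b (h * g) y - b h (g • y) - b g y| ≤ K

/-- Moving the base point to gy reindexes by k ↦ kg and shifts the values by b(g, y), up to K. -/
theorem IsQuasiCocycle.hasInfiniteSuperlevel_smul {K : ℝ} {b : G → Y → ℝ}
    (hb : IsQuasiCocycle K b) {g : G} {y : Y} (h : HasInfiniteSuperlevel fun k => b k y) :
    HasInfiniteSuperlevel fun k => b k (g • y) := by
  refine (h.comp_equiv (Equiv.mulRight g)).of_le_add (C := K + b g y) fun k => ?_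
  have := (abs_le.1 (hb g k y)).2
  simp only [Function.comp_apply, Equiv.coe_mulRight]
  linarith

theorem IsQuasiCocycle.hasInfiniteSuperlevel_smul_iff {K : ℝ} {b : G → Y → ℝ}
    (hb : IsQuasiCocycle K b) (g : G) (y : Y) :
    (HasInfiniteSuperlevel fun k => b k (g • y)) ↔ HasInfiniteSuperlevel fun k => b k y :=
  ⟨fun h => by simpa using hb.hasInfiniteSuperlevel_smul (g := g⁻¹) h,
    hb.hasInfiniteSuperlevel_smul⟩

end QuasiCocycle

/-! ### The Hopf decomposition from a density cocycle. -/

section AbstractHopf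

variable {G : Type*} [Group G] {Y : Type*} [MeasurableSpace Y] [MulAction G Y]

/-- `F g` is the logarithm of the density of `A ↦ m (g • A)` with respect to `m`. -/
structure IsLogDensity (m : Measure Y) (F : G → Y → ℝ) : Prop where
  measurable : ∀ g, Measurable (F g)
  measure_smul : ∀ g A, MeasurableSet A →
    m (g • A) = ∫⁻ y in A, ENNReal.ofReal (Real.exp (F g y)) ∂m

section Measure

variable [MeasurableConstSMul G Y] {m : Measure Y} {F : G → Y → ℝ}

theorem IsLogDensity.quasiMeasurePreserving (hF : IsLogDensity m F) (g : G) :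
    Measure.QuasiMeasurePreserving (fun y : Y => g • y) m m := by
  refine ⟨measurable_const_smul g, Measure.AbsolutelyContinuous.mk fun A hA h0 => ?_⟩
  rw [Measure.map_apply (measurable_const_smul g) hA, preimage_smul, hF.measure_smul _ _ hA,
    Measure.restrict_eq_zero.2 h0, lintegral_zero_measure]

theorem IsLogDensity.ae_smul (hF : IsLogDensity m F) (g : G) {p : Y → Prop}
    (h : ∀ᵐ y ∂m, p y) : ∀ᵐ y ∂m, p (g • y) :=
  (hF.quasiMeasurePreserving g).tendsto_ae.eventually h

theorem IsLogDensity.smul_ae_eq (hF : IsLogDensity m F) (g : G) {A B : Set Y} (h : A =ᵐ[m] B) :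
    (g • A : Set Y) =ᵐ[m] (g • B : Set Y) := by
  rw [← preimage_smul_inv, ← preimage_smul_inv]
  exact (hF.quasiMeasurePreserving g⁻¹).preimage_ae_eq h

variable [Countable G]

/-- Almost every point of `A` whose density cocycle does not tend to zero along its orbit returns
to `A` infinitely often. -/
theorem IsLogDensity.ae_infinite_of_hasInfiniteSuperlevel [IsFiniteMeasure m]
    (hF : IsLogDensity m F) {A : Set Y} (hA : MeasurableSet A) :
    ∀ᵐ y ∂m, (HasInfiniteSuperlevel fun g => F g y) → y ∈ A → {g : G | g • y ∈ A}.Infinite := by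
  -- The number of visits of the orbit to A, an invariant function.
  let k : Y → ENNReal := fun y => ∑' g : G, A.indicator 1 (g • y)
  have hk_smul : ∀ (g : G) y, k (g • y) = k y := by
    intro g y
    have h := (Equiv.mulRight g).tsum_eq fun h : G => A.indicator (1 : Y → ENNReal) (h • y)
    simpa [k, mul_smul] using h
  have hk : Measurable k := by
    refine Measurable.tsum fun g => ?_
    exact (measurable_one.indicator hA).comp (measurable_const_smul g)
  have hk_fin : ∀ y, {g : G | g • y ∈ A}.Finite → k y < ⊤ := by
    intro y hy
    have : k y = ∑' g : G, {g : G | g • y ∈ A}.indicator 1 g := rfl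
    rw [this, tsum_eq_sum (s := hy.toFinset) fun g hg => indicator_of_notMem
      (fun h => hg (hy.mem_toFinset.2 h)) _]
    refine ENNReal.sum_lt_top.2 fun g _ => ?_
    exact (indicator_le_self' (fun _ _ => zero_le) g).trans_lt ENNReal.one_lt_top
  let B : ℕ → Set Y := fun N => A ∩ {y | k y ≤ N}
  have hB : ∀ N, MeasurableSet (B N) := fun N => hA.inter (hk measurableSet_Iic)
  have hfin : ∀ N, ∀ᵐ y ∂m, y ∈ B N →
      ∑' g : G, ENNReal.ofReal (Real.exp (F g y)) < ⊤ := by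
    intro N
    have hmeas : ∀ g : G, Measurable fun y => ENNReal.ofReal (Real.exp (F g y)) := fun g =>
      (Real.measurable_exp.comp (hF.measurable g)).ennreal_ofReal
    rw [← ae_restrict_iff' (hB N)]
    refine ae_lt_top (Measurable.tsum hmeas) (ne_of_lt ?_)
    rw [lintegral_tsum fun g => (hmeas g).aemeasurable]
    calc ∑' g : G, ∫⁻ y in B N, ENNReal.ofReal (Real.exp (F g y)) ∂m
        = ∑' g : G, ∫⁻ y, (g • B N : Set Y).indicator 1 y ∂m := by
          congr 1
          funext g
          rw [← hF.measure_smul g _ (hB N), lintegral_indicator_one ((hB N).const_smul g)]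
      _ = ∫⁻ y, ∑' g : G, (g • B N : Set Y).indicator 1 y ∂m :=
          (lintegral_tsum fun g =>
            (measurable_one.indicator ((hB N).const_smul g)).aemeasurable).symm
      _ ≤ ∫⁻ _, N ∂m := by
          refine lintegral_mono fun y => ?_
          by_cases hy : k y ≤ N
          · refine le_trans ?_ hy
            -- Since y ∈ gB iff g⁻¹y ∈ B, inverting the index turns the number of translates of B
            -- covering y into a visit count, at most k(y).
            have h := (Equiv.inv G).tsum_eq fun h : G => A.indicator (1 : Y → ENNReal) (h • y)
            simp only [Equiv.inv_apply] at h
            simp only [k]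
            rw [← h]
            refine ENNReal.tsum_le_tsum fun g => ?_
            rw [← preimage_smul_inv]
            exact indicator_le_indicator_of_subset (s := B N) (f := (1 : Y → ENNReal)) inter_subset_left
              (fun _ => zero_le_one) (g⁻¹ • y)
          · refine (ENNReal.tsum_eq_zero.2 fun g => indicator_of_notMem (fun h => hy ?_) _).trans_le
              zero_le
            rw [mem_smul_set_iff_inv_smul_mem] at h
            exact (hk_smul g⁻¹ y).symm.trans_le h.2
      _ < ⊤ := by
          rw [lintegral_const]
          exact ENNReal.mul_lt_top (ENNReal.natCast_lt_top N) (measure_lt_top m _)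
  filter_upwards [ae_all_iff.2 hfin] with y hy ⟨c, hc⟩ hyA hAfin
  obtain ⟨N, hN⟩ := ENNReal.exists_nat_gt (hk_fin y hAfin).ne
  refine hc ((ENNReal.finite_const_le_of_tsum_ne_top (hy N ⟨hyA, hN.le⟩).ne
    (ε := ENNReal.ofReal (Real.exp c)) (by simp [Real.exp_pos])).subset fun g hg => ?_)
  exact ENNReal.ofReal_le_ofReal (Real.exp_le_exp.2 hg)

end Measure

/-! ### Measurable sections -/

section CountablySeparated

variable [MeasurableConstSMul G Y] [MeasurableSpace.CountablySeparated Y]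

theorem exists_measurable_injective_real (Y : Type*) [MeasurableSpace Y]
    [MeasurableSpace.CountablySeparated Y] :
    ∃ φ : Y → ℝ, Measurable φ ∧ Function.Injective φ := by
  obtain ⟨f, hf, hfi⟩ := MeasurableSpace.measurable_injection_nat_bool_of_countablySeparated Y
  have he := measurableEmbedding_embeddingReal (ℕ → Bool)
  exact ⟨_, he.measurable.comp hf, he.injective.comp hfi⟩

theorem measurableSet_fixedBy_of_countablySeparated (g : G) :
    MeasurableSet (MulAction.fixedBy Y g) := by
  obtain ⟨φ, hφ, hφi⟩ := exists_measurable_injective_real Y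
  have : MulAction.fixedBy Y g = {y | φ (g • y) = φ y} := by
    ext y
    exact hφi.eq_iff.symm
  rw [this]
  exact measurableSet_eq_fun (hφ.comp (measurable_const_smul g)) hφ

variable [Countable G]

/-- In each orbit meeting M, keep the point of M with the least value of an injective real function;
finiteness gives existence, injectivity uniqueness. -/
theorem exists_isCofiniteSection {M : Set Y} (hM : MeasurableSet M)
    (hfin : ∀ y ∈ M, {g : G | g • y ∈ M}.Finite) :
    ∃ W, IsCofiniteSection G W ∧ ⋃ g : G, g • W = ⋃ g : G, g • M := by
  obtain ⟨φ, hφ, hφi⟩ := exists_measurable_injective_real Y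
  refine ⟨M ∩ ⋂ g : G, {y | g • y ∈ M → φ y ≤ φ (g • y)}, ⟨?_, ?_⟩, ?_⟩
  · refine hM.inter (MeasurableSet.iInter fun g => ?_)
    exact (measurable_const_smul g hM).imp
      (measurableSet_le hφ (hφ.comp (measurable_const_smul g)))
  · rintro y ⟨hy, hmin⟩
    rw [mem_iInter] at hmin
    refine ⟨fun g ⟨hgy, hgmin⟩ => hφi (le_antisymm ?_ (hmin g hgy)), ?_⟩
    · have := mem_iInter.1 hgmin g⁻¹
      simp only [mem_ofPred_eq, inv_smul_smul] at this
      exact this hy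
    · refine (hfin y hy).subset fun g hg => ?_
      rw [SetLike.mem_coe, MulAction.mem_stabilizer_iff] at hg
      simpa [hg] using hy
  · refine subset_antisymm (iUnion_mono fun g => smul_set_mono inter_subset_left) ?_
    refine iUnion_subset fun g => ?_
    rintro _ ⟨y, hy, rfl⟩
    obtain ⟨h, hh, hmin⟩ := exists_min_image _ (fun k : G => φ (k • y)) (hfin y hy)
      ⟨1, by simpa using hy⟩
    refine mem_iUnion.2 ⟨g * h⁻¹, mem_smul_set.2 ⟨h • y, ⟨hh, mem_iInter.2 fun k hk => ?_⟩, ?_⟩⟩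
    · rw [← mul_smul] at hk ⊢
      exact hmin (k * h) hk
    · simp [mul_smul]

variable {m : Measure Y} {F : G → Y → ℝ}

/-- The set where the density cocycle tends to zero along the orbit is, up to a null set, the
saturation of a section. -/
theorem IsLogDensity.exists_isCofiniteSection_ae_eq (hF : IsLogDensity m F) {b : G → Y → ℝ}
    {K C : ℝ} (hb : IsQuasiCocycle K b) (hFb : ∀ᵐ y ∂m, ∀ g, |F g y - b g y| ≤ C) :
    ∃ W, IsCofiniteSection G W ∧
      (⋃ g : G, g • W) =ᵐ[m] {y | HasInfiniteSuperlevel fun g => b g y}ᶜ := by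
  obtain ⟨T, hTsub, hT, hT0⟩ := exists_measurable_superset_of_null hFb
  -- An invariant conull set: there the bound |F - b| ≤ C holds along the whole orbit.
  let Z : Set Y := ⋂ g : G, (fun y => g • y) ⁻¹' Tᶜ
  have hZ : MeasurableSet Z := MeasurableSet.iInter fun g => measurable_const_smul g hT.compl
  have hZae : ∀ᵐ y ∂m, y ∈ Z := by
    have h : ∀ᵐ y ∂m, y ∈ Tᶜ := measure_eq_zero_iff_ae_notMem.1 hT0
    filter_upwards [ae_all_iff.2 fun g : G => hF.ae_smul g h] with y hy
    exact mem_iInter.2 hy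
  have hZF : ∀ y ∈ Z, ∀ g, |F g y - b g y| ≤ C := by
    intro y hy
    have h1 := mem_iInter.1 hy 1
    simp only [mem_preimage, one_smul] at h1
    by_contra h
    exact h1 (hTsub h)
  have hZsmul : ∀ (g : G), ∀ y ∈ Z, g • y ∈ Z := by
    intro g y hy
    refine mem_iInter.2 fun h => ?_
    rw [mem_preimage, ← mul_smul]
    exact mem_iInter.1 hy (h * g)
  -- Points at nearly maximal position in their orbit; the slack K + C absorbs the cocycle error and
  -- the passage from b to F.
  let M : Set Y := (Z ∩ {y | HasInfiniteSuperlevel fun g => F g y}ᶜ) ∩ ⋂ g, {y | F g y ≤ K + C}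
  have hM : MeasurableSet M := (hZ.inter
    (measurableSet_setOf_hasInfiniteSuperlevel hF.measurable).compl).inter
      (MeasurableSet.iInter fun g => measurableSet_le (hF.measurable g) measurable_const)
  have hMb : ∀ y ∈ M, ¬ HasInfiniteSuperlevel fun g => b g y := fun y hy h =>
    hy.1.2 ((hasInfiniteSuperlevel_congr (hZF y hy.1.1)).2 h)
  have hMfin : ∀ y ∈ M, {g : G | g • y ∈ M}.Finite := by
    intro y hy
    by_contra hinf
    -- Here b(1, y) ≥ -K, b(g⁻¹, gy) ≤ K + 2C, and the cocycle identity costs another K.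
    refine hMb y hy ⟨-(3 * K + 2 * C), Set.Infinite.mono (fun g hg => ?_) hinf⟩
    have h₁ := abs_le.1 (hb 1 1 y)
    have h₂ := abs_le.1 (hb g g⁻¹ y)
    have h₃ := abs_le.1 (hZF _ hg.1.1 g⁻¹)
    have h₄ : F g⁻¹ (g • y) ≤ K + C := mem_iInter.1 hg.2 g⁻¹
    rw [one_smul, mul_one] at h₁
    rw [inv_mul_cancel] at h₂
    show -(3 * K + 2 * C) ≤ b g y
    linarith
  obtain ⟨W, hW, hWM⟩ := exists_isCofiniteSection hM hMfin
  refine ⟨W, hW, ?_⟩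
  rw [hWM]
  filter_upwards [hZae] with y hyZ
  refine propext ⟨fun h => ?_, fun h => ?_⟩
  · obtain ⟨g, y, hy, rfl⟩ := mem_iUnion.1 h
    exact fun h => hMb y hy ((hb.hasInfiniteSuperlevel_smul_iff g y).1 h)
  · have hlev : ∀ c, {g | c ≤ b g y}.Finite := fun c => by
      by_contra hc
      exact h ⟨c, hc⟩
    obtain ⟨g, -, hmax⟩ := exists_max_image _ (fun g => b g y) (hlev (b 1 y))
      ⟨1, le_refl (b 1 y)⟩
    have hmax' : ∀ k, b k y ≤ b g y := by
      intro k
      rcases le_total (b 1 y) (b k y) with hk | hk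
      · exact hmax k hk
      · exact hk.trans (hmax 1 (le_refl (b 1 y)))
    refine mem_iUnion.2 ⟨g⁻¹, mem_smul_set_iff_inv_smul_mem.2 ?_⟩
    rw [inv_inv]
    have hgZ := hZsmul g y hyZ
    refine ⟨⟨hgZ, fun h' => h ?_⟩, mem_iInter.2 fun k => ?_⟩
    · exact (hb.hasInfiniteSuperlevel_smul_iff g y).1
        ((hasInfiniteSuperlevel_congr (hZF _ hgZ)).1 h')
    · have h₁ := abs_le.1 (hb g k y)
      have h₂ := abs_le.1 (hZF _ hgZ k)
      have h₃ := hmax' (k * g)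
      show F k (g • y) ≤ K + C
      linarith

theorem IsLogDensity.isInfinitelyConservativePart [IsFiniteMeasure m] (hF : IsLogDensity m F)
    {b : G → Y → ℝ} {K C : ℝ} (hb : IsQuasiCocycle K b)
    (hFb : ∀ᵐ y ∂m, ∀ g, |F g y - b g y| ≤ C) {Λ : Set Y}
    (hΛ : ∀ᵐ y ∂m, y ∈ Λ ↔ HasInfiniteSuperlevel fun g => b g y) :
    IsInfinitelyConservativePart G m Λ := by
  have hΛb : Λ =ᵐ[m] {y | HasInfiniteSuperlevel fun g => b g y} :=
    hΛ.mono fun y hy => propext hy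
  have hΛF : Λ =ᵐ[m] {y | HasInfiniteSuperlevel fun g => F g y} := by
    filter_upwards [hΛ, hFb] with y hy hy'
    exact propext (hy.trans (hasInfiniteSuperlevel_congr hy').symm)
  refine ⟨?_, fun g => ?_, fun A hA hAΛ => ?_, ?_⟩
  · exact (measurableSet_setOf_hasInfiniteSuperlevel hF.measurable).nullMeasurableSet.congr
      hΛF.symm
  · refine (hF.smul_ae_eq g hΛb).trans (EventuallyEq.trans (EventuallyEq.of_eq ?_) hΛb.symm)
    rw [← preimage_smul_inv]
    ext y
    exact hb.hasInfiniteSuperlevel_smul_iff g⁻¹ y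
  · filter_upwards [hF.ae_infinite_of_hasInfiniteSuperlevel hA, hΛF.mem_iff] with y hy hyF hyA
    exact hy (hyF.1 (hAΛ hyA)) hyA
  · obtain ⟨W, hW, hWb⟩ := hF.exists_isCofiniteSection_ae_eq hb hFb
    exact ⟨W, hW, hWb.trans hΛb.symm.compl⟩

end CountablySeparated

/-! ### From the infinitely conservative part to the conservative part -/

theorem setOf_stabilizer_ne_bot_eq_iUnion (G Y : Type*) [Group G] [MulAction G Y] :
    {y : Y | MulAction.stabilizer G y ≠ ⊥} = ⋃ g : {g : G // g ≠ 1}, MulAction.fixedBy Y g.1 := by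
  ext y
  simp [Subgroup.ne_bot_iff_exists_ne_one, and_comm]

theorem stabilizer_smul_ne_bot_iff {G Y : Type*} [Group G] [MulAction G Y] (g : G) (y : Y) :
    MulAction.stabilizer G (g • y) ≠ ⊥ ↔ MulAction.stabilizer G y ≠ ⊥ := by
  rw [MulAction.stabilizer_smul_eq_stabilizer_map_conj]
  exact (Subgroup.map_eq_bot_iff_of_injective _ (MulAut.conj g).injective).not

theorem smul_setOf_stabilizer_ne_bot {G Y : Type*} [Group G] [MulAction G Y] (g : G) :
    g • {y : Y | MulAction.stabilizer G y ≠ ⊥} = {y : Y | MulAction.stabilizer G y ≠ ⊥} := by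
  rw [← preimage_smul_inv]
  ext y
  exact stabilizer_smul_ne_bot_iff g⁻¹ y

section Stabilizer

variable [Countable G] [MeasurableConstSMul G Y] [MeasurableSpace.CountablySeparated Y]
  {m : Measure Y} {C : Set Y}

variable (G Y) in
theorem measurableSet_setOf_stabilizer_ne_bot :
    MeasurableSet {y : Y | MulAction.stabilizer G y ≠ ⊥} := by
  rw [setOf_stabilizer_ne_bot_eq_iUnion]
  exact MeasurableSet.iUnion fun g => measurableSet_fixedBy_of_countablySeparated g.1

/-- If gW and hW share a point y, then h⁻¹g returns g⁻¹y to W, so fixes it, so is trivial. -/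
theorem IsCofiniteSection.isWanderingSet_diff {W : Set Y} (hW : IsCofiniteSection G W) :
    IsWanderingSet G (W \ {y | MulAction.stabilizer G y ≠ ⊥}) := by
  refine ⟨hW.1.diff (measurableSet_setOf_stabilizer_ne_bot G Y), fun g h hgh => ?_⟩
  refine disjoint_left.2 fun y hy hy' => hgh ?_
  rw [mem_smul_set_iff_inv_smul_mem] at hy hy'
  have hfix : (h⁻¹ * g) • g⁻¹ • y = g⁻¹ • y := by
    refine (hW.2 _ hy.1).1 _ ?_
    rw [← mul_smul, mul_inv_cancel_right]
    exact hy'.1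
  have hbot := not_not.1 hy.2
  have hmem : h⁻¹ * g ∈ MulAction.stabilizer G (g⁻¹ • y) := hfix
  rw [hbot, Subgroup.mem_bot, inv_mul_eq_one] at hmem
  exact hmem.symm

/-- Adding the points with non-trivial stabilizers to the infinitely conservative part gives the
conservative part. -/
theorem IsInfinitelyConservativePart.isConservativePart_union
    (h : IsInfinitelyConservativePart G m C) :
    IsConservativePart G m (C ∪ {y | MulAction.stabilizer G y ≠ ⊥}) := by
  have hS := measurableSet_setOf_stabilizer_ne_bot G Y
  refine ⟨h.nullMeasurable.union hS.nullMeasurableSet, fun g => ?_, fun A hA hAC => ?_, ?_⟩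
  · rw [smul_set_union, smul_setOf_stabilizer_ne_bot]
    exact (h.invariant g).union (EventuallyEq.refl _ _)
  · filter_upwards [h.conservative _ (hA.diff hS) (sdiff_subset_iff.2 (union_comm C _ ▸ hAC))]
      with y hy hyA
    by_cases hyS : MulAction.stabilizer G y = ⊥
    · obtain ⟨g, hg, hg1⟩ := (hy ⟨hyA, not_not.2 hyS⟩).exists_notMem_finset {1}
      exact ⟨g, by simpa using hg1, hg.1⟩
    · obtain ⟨⟨g, hg⟩, hg1⟩ := (Subgroup.ne_bot_iff_exists_ne_one).1 hyS
      rw [MulAction.mem_stabilizer_iff] at hg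
      exact ⟨g, fun h1 => hg1 (Subtype.ext h1), by rwa [hg]⟩
  · obtain ⟨W, hW, hWC⟩ := h.dissipative
    refine ⟨_, hW.isWanderingSet_diff, ?_⟩
    have hU : (⋃ g : G, g • (W \ {y | MulAction.stabilizer G y ≠ ⊥})) =
        (⋃ g : G, g • W) ∩ {y | MulAction.stabilizer G y ≠ ⊥}ᶜ := by
      rw [iUnion_inter]
      refine iUnion_congr fun g => ?_
      rw [smul_set_sdiff, smul_setOf_stabilizer_ne_bot, sdiff_eq]
    rw [hU]
    refine (hWC.inter (EventuallyEq.refl _ _)).trans (EventuallyEq.of_eq ?_)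
    exact (compl_union C _).symm

theorem IsInfinitelyConservativePart.isConservativePart_of_free
    (h : IsInfinitelyConservativePart G m C)
    (hfree : ∀ g : G, g ≠ 1 → m (MulAction.fixedBy Y g) = 0) : IsConservativePart G m C := by
  have hC : (C ∪ {y | MulAction.stabilizer G y ≠ ⊥} : Set Y) =ᵐ[m] C := by
    refine union_ae_eq_left_of_ae_eq_empty (ae_eq_empty.2 ?_)
    rw [setOf_stabilizer_ne_bot_eq_iUnion]
    exact measure_iUnion_null fun g => hfree g.1 g.2
  obtain ⟨W, hW, hWC⟩ := h.isConservativePart_union.dissipative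
  exact ⟨h.nullMeasurable, h.invariant, fun A hA hAC =>
    h.isConservativePart_union.conservative A hA (hAC.trans subset_union_left),
    W, hW, hWC.trans hC.compl⟩

end Stabilizer

end AbstractHopf

/-! ### Application to quasi-conformal streams. -/

section QuasiConformal

variable {X : Type*} [MetricSpace X] [GromovHyperbolicSpace X]

/-- Split β_ω(g⁻¹h⁻¹x, x) at g⁻¹x; by equivariance the first piece is β_{gω}(h⁻¹x, x). -/
theorem IsHyperbolicConst.isQuasiCocycle_busemann {δ : ℝ} (hδ : IsHyperbolicConst X δ)
    (G : Subgroup (X ≃ᵢ X)) {D : ℝ} (hD : 0 ≤ D) (x : X) :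
    IsQuasiCocycle (Y := HypBoundary X) (D * (6 * δ))
      fun (g : G) ω => D * busemann ω ((g⁻¹ : X ≃ᵢ X) x) x := by
  intro g h ω
  have h₁ := busemann_smul (g⁻¹ : X ≃ᵢ X) (g • ω) ((h⁻¹ : X ≃ᵢ X) x) x
  rw [show (g⁻¹ : X ≃ᵢ X) • g • ω = ω from inv_smul_smul g ω] at h₁
  have h₂ := hδ.abs_busemann_add_sub_le ω (((h * g : G)⁻¹ : X ≃ᵢ X) x) ((g⁻¹ : X ≃ᵢ X) x) x
  have h₃ : ((h * g : G)⁻¹ : X ≃ᵢ X) x = (g⁻¹ : X ≃ᵢ X) ((h⁻¹ : X ≃ᵢ X) x) := by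
    rw [Subgroup.coe_mul, mul_inv_rev]
    rfl
  beta_reduce
  rw [← h₁]
  rw [h₃] at h₂ ⊢
  rw [← mul_sub, ← mul_sub, abs_mul, abs_of_nonneg hD]
  exact mul_le_mul_of_nonneg_left h₂ hD

theorem hasInfiniteSuperlevel_const_mul {ι : Type*} {D : ℝ} (hD : 0 < D) {f : ι → ℝ} :
    (HasInfiniteSuperlevel fun i => D * f i) ↔ HasInfiniteSuperlevel f := by
  constructor
  · rintro ⟨c, hc⟩
    refine ⟨c / D, hc.mono fun i (hi : c ≤ D * f i) => ?_⟩
    exact (div_le_iff₀' hD).2 hi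
  · rintro ⟨c, hc⟩
    exact ⟨D * c, hc.mono fun i (hi : c ≤ f i) => mul_le_mul_of_nonneg_left hi hD.le⟩

/-- If the boundary has at least two points, then membership in the big horospheric limit set
means that the Busemann function does not tend to infinity along the orbit. -/
theorem mem_bigHorosphericLimitSet_iff [ProperSpace X] [Nontrivial (HypBoundary X)]
    {G : Subgroup (X ≃ᵢ X)} (hG : IsDiscreteIsometryGroup G) (o x : X) (ω : HypBoundary X) :
    ω ∈ bigHorosphericLimitSet G o ↔
      HasInfiniteSuperlevel fun g : G => busemann ω ((g⁻¹ : X ≃ᵢ X) x) x := by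
  obtain ⟨δ, hδ⟩ := exists_isHyperbolicConst X
  have horb : ∀ p, (horoball ω p ∩ range (fun g : G => (g : X ≃ᵢ X) o)).Infinite ↔
      {g : G | busemann ω p ((g : X ≃ᵢ X) o) ≤ 0}.Infinite := by
    intro p
    have himg : horoball ω p ∩ range (fun g : G => (g : X ≃ᵢ X) o) =
        (fun g : G => (g : X ≃ᵢ X) o) '' {g : G | busemann ω p ((g : X ≃ᵢ X) o) ≤ 0} := by
      rw [← image_univ, inter_comm, ← image_inter_preimage, univ_inter]
      rfl
    rw [himg]
    refine ⟨fun h h' => h (h'.image _), fun h h' => h ?_⟩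
    -- Orbit points may be counted as group elements because each is hit by finitely many of them.
    refine (h'.preimage' (f := fun g : G => (g : X ≃ᵢ X) o) fun y _ => ?_).subset
      (subset_preimage_image _ _)
    refine (hG.finite_setOf_dist_le o y 0).subset fun g hg => ?_
    exact (dist_eq_zero.2 hg).le
  have hcomp : ∀ (p : X) (g : G), |-busemann ω p ((g : X ≃ᵢ X) o) -
      busemann ω ((g : X ≃ᵢ X) x) x| ≤ dist o x + dist x p + 18 * δ := by
    intro p g
    have h₀ := hδ.1
    have h₁ := abs_le.1 (hδ.abs_busemann_add_sub_le ω p ((g : X ≃ᵢ X) o) ((g : X ≃ᵢ X) x))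
    have h₂ := abs_le.1 (hδ.abs_busemann_add_sub_le ω p ((g : X ≃ᵢ X) x) x)
    have h₃ := abs_le.1 (abs_busemann_le ω ((g : X ≃ᵢ X) o) ((g : X ≃ᵢ X) x))
    have h₄ := abs_le.1 (abs_busemann_le ω p x)
    rw [IsometryEquiv.dist_eq] at h₃
    rw [dist_comm x p]
    refine abs_le.2 ⟨?_, ?_⟩ <;> linarith
  have hinv : (HasInfiniteSuperlevel fun g : G => busemann ω ((g⁻¹ : X ≃ᵢ X) x) x) ↔
      HasInfiniteSuperlevel fun g : G => busemann ω ((g : X ≃ᵢ X) x) x := by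
    refine ⟨fun h => ?_, fun h => ?_⟩
    · convert h.comp_equiv (Equiv.inv G) using 1
      funext g
      simp
    · exact h.comp_equiv (Equiv.inv G)
  rw [hinv]
  constructor
  · rintro ⟨p, hp⟩
    refine (hasInfiniteSuperlevel_congr (hcomp p)).1 ⟨0, ((horb p).1 hp).mono
      fun g (hg : busemann ω p ((g : X ≃ᵢ X) o) ≤ 0) => ?_⟩
    exact neg_nonneg.2 hg
  · intro h
    obtain ⟨c, hc⟩ := (hasInfiniteSuperlevel_congr (hcomp x)).2 h
    -- A horoball large enough to contain the superlevel set at c; 6δ is the cocycle error.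
    obtain ⟨p, hp⟩ := hδ.exists_le_busemann ω x (6 * δ - c)
    refine ⟨p, (horb p).2 (hc.mono fun g (hg : c ≤ _) => ?_)⟩
    have h₁ := abs_le.1 (hδ.abs_busemann_add_sub_le ω x p ((g : X ≃ᵢ X) o))
    show busemann ω p ((g : X ≃ᵢ X) o) ≤ 0
    linarith

/-- Invariance gives λ_{g⁻¹x}(A) = λ_x(gA); equivalence makes the derivative positive a.e., so exp
undoes log. -/
theorem isLogDensity_log_rnDeriv {G : Subgroup (X ≃ᵢ X)} {D : ℝ} {μ : X → Measure (HypBoundary X)}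
    (hμ : IsQuasiConformalStream D μ) (hinv : IsInvariantStream G μ) (x : X) :
    IsLogDensity (μ x) fun (g : G) ω =>
      Real.log ((μ ((g⁻¹ : X ≃ᵢ X) x)).rnDeriv (μ x) ω).toReal := by
  have := hμ.finite
  refine ⟨fun g => (Measure.measurable_rnDeriv _ _).ennreal_toReal.log, fun g A hA => ?_⟩
  set y := (g⁻¹ : X ≃ᵢ X) x with hy
  have hmap : μ y A = μ x (g • A) := by
    rw [show y = ((g⁻¹ : G) : X ≃ᵢ X) x from rfl, hinv g⁻¹ x,
      Measure.map_apply (measurable_const_smul (g⁻¹ : G)) hA, preimage_smul_inv]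
  rw [← hmap, ← Measure.setLIntegral_rnDeriv (hμ.equivalent y x) A]
  refine lintegral_congr_ae (ae_restrict_of_ae ?_)
  filter_upwards [(hμ.equivalent x y).ae_le (Measure.rnDeriv_pos (hμ.equivalent y x)),
    Measure.rnDeriv_lt_top (μ y) (μ x)] with ω h₁ h₂
  rw [Real.exp_log (ENNReal.toReal_pos h₁.ne' h₂.ne), ENNReal.ofReal_toReal h₂.ne]

end QuasiConformal

theorem mainTheorem1 {X : Type*} [MetricSpace X] [ProperSpace X] [GromovHyperbolicSpace X]
    (G : Subgroup (X ≃ᵢ X)) (hG : IsDiscreteIsometryGroup G)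
    (D : ℝ) (μ : X → Measure (HypBoundary X))
    (hμ : IsQuasiConformalStream D μ) (hinv : IsInvariantStream G μ)
    (hna : ∀ (x : X) (ω : HypBoundary X), μ x {ω} = 0) (o x : X) :
    ((∀ g : G, g ≠ 1 → μ x (MulAction.fixedBy (HypBoundary X) g) = 0) →
      IsConservativePart G (μ x) (bigHorosphericLimitSet G o)) ∧
    IsConservativePart G (μ x)
      (bigHorosphericLimitSet G o ∪ {ω | MulAction.stabilizer G ω ≠ ⊥}) ∧
    IsInfinitelyConservativePart G (μ x) (bigHorosphericLimitSet G o) := by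
  obtain ⟨δ, hδ⟩ := exists_isHyperbolicConst X
  obtain ⟨C, -, hC⟩ := hμ.exists_bound
  have := hμ.finite
  have := hG.countable o
  have := HypBoundary.countablySeparated o
  have hbound : ∀ᵐ ω ∂μ x, ∀ g : G,
      |Real.log ((μ ((g⁻¹ : X ≃ᵢ X) x)).rnDeriv (μ x) ω).toReal -
        D * busemann ω ((g⁻¹ : X ≃ᵢ X) x) x| ≤ C := ae_all_iff.2 fun g => hC _ x
  have hΛ : ∀ᵐ ω ∂μ x, ω ∈ bigHorosphericLimitSet G o ↔
      HasInfiniteSuperlevel fun g : G => D * busemann ω ((g⁻¹ : X ≃ᵢ X) x) x := by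
    rcases subsingleton_or_nontrivial (HypBoundary X) with hs | hn
    -- On a boundary with at most one point the horoball criterion is unavailable, but non-atomicity
    -- kills the measure.
    · have h0 : μ x = 0 := by
        rw [← Measure.measure_univ_eq_zero]
        rcases isEmpty_or_nonempty (HypBoundary X) with he | ⟨⟨ω⟩⟩
        · rw [univ_eq_empty_iff.2 he, measure_empty]
        · rw [Subsingleton.eq_univ_of_nonempty (s := {ω}) (singleton_nonempty ω) |>.symm]
          exact hna x ω
      simp [h0]
    · refine Eventually.of_forall fun ω => ?_
      rw [hasInfiniteSuperlevel_const_mul hμ.dim_pos]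
      exact mem_bigHorosphericLimitSet_iff hG o x ω
  have h := (isLogDensity_log_rnDeriv hμ hinv x).isInfinitelyConservativePart
    (hδ.isQuasiCocycle_busemann G hμ.dim_pos.le x) hbound hΛ
  exact ⟨h.isConservativePart_of_free, h.isConservativePart_union, h⟩
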